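/- Let $p$ be a prime, let $\Gamma$ be a smooth group scheme over $\mathbb{Z}_p$, and let $X$, $Y$, $Z$ be $\mathbb{Z}_p$-schemes endowed with an action of $\Gamma$. Let $f : X \to Z$ and $g : Y \to Z$ be $\Gamma$-equivariant morphisms of $\mathbb{Z}_p$-schemes. Suppose that $X$ is reduced, that $g$ is separated, and that there is a dense open subscheme $Z^0 \subset Z$ such that $f^{-1}(Z^0)$ is dense in $X$ and $g$ is an immersion over $Z^0$ (that is, $g^{-1}(Z^0) \to Z^0$ is an immersion). Let $U \subset X$ be a $\Gamma$-saturating open subscheme, i.e. an open subscheme such that the morphism $\Gamma \times_{\mathbb{Z}_p} U \to X$, $(\gamma, u) \mapsto \gamma \cdot u$, given by the action is surjective. Suppose that there is a morphism $h_U : U \to Y$ with $g \circ h_U = f|_U$. Then $h_U$ is the only morphism $U \to Y$ with this property, and there is one and only one morphism $h : X \to Y$ with $g \circ h = f$. This morphism satisfies $h|_U = h_U$, it is $\Gamma$-equivariant, and it is proper if $f$ is proper. -/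

import Mathlib

open CategoryTheory MonoidalCategory AlgebraicGeometry
open scoped MonObj

universe u

/-- The base scheme `Spec ℤ_p`, in an arbitrary universe. -/
noncomputable abbrev SpecZp (p : ℕ) [Fact p.Prime] : Scheme.{u} :=
  Spec (.of (ULift.{u} ℤ_[p]))

/-- An open subscheme `U` of an `S`-scheme `X`, as an `S`-scheme. -/
noncomputable abbrev openOver {S : Scheme.{u}} (X : Over S) (U : X.left.Opens) : Over S :=
  Over.mk (U.ι ≫ X.hom)

/-- The inclusion `U ⟶ X` of an open subscheme, as a morphism of `S`-schemes. -/
noncomputable abbrev openOverι {S : Scheme.{u}} (X : Over S) (U : X.left.Opens) :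
    openOver X U ⟶ X :=
  Over.homMk U.ι

/-- The restricted action morphism `Γ ×_S U ⟶ X`, `(γ, u) ↦ γ • u`, for an open `U ⊆ X`
of an `S`-scheme `X` with an action of the `S`-group scheme `Γ`. -/
noncomputable def restrictedAction {S : Scheme.{u}} (Γ X : Over S) [GrpObj Γ] [ModObj Γ X]
    (U : X.left.Opens) : Γ ⊗ openOver X U ⟶ X :=
  Γ ◁ openOverι X U ≫ γ[Γ, X]

/-- An open `U ⊆ X` is `Γ`-saturating if `Γ ×_S U ⟶ X`, `(γ, u) ↦ γ • u`, is surjective. -/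
def IsSaturating {S : Scheme.{u}} (Γ X : Over S) [GrpObj Γ] [ModObj Γ X]
    (U : X.left.Opens) : Prop :=
  Surjective (restrictedAction Γ X U).left

open Limits TensorProduct

/-! A morphism to `Y` from a reduced scheme is determined by its composite with `g`, provided that
the preimage of `Z₀` is dense (`hom_ext_of_dense_of_mono_morphismRestrict`). The action map `Γ × U ⟶
X` is smooth and surjective, so `h` is obtained by descending `(γ, u) ↦ γ • h_U(u)` along it. The
descent condition and equivariance follow from the uniqueness principle, since schemes smooth over
`X` are reduced and smooth maps, being open, pull dense opens back to dense opens. -/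

theorem AlgebraicGeometry.isReduced_of_forall_exists_isAffineOpen {X : Scheme.{u}}
    (H : ∀ x : X, ∃ V : X.Opens, IsAffineOpen V ∧ x ∈ V ∧ _root_.IsReduced Γ(X, V)) :
    IsReduced X := by
  suffices ∀ x : X, _root_.IsReduced (X.presheaf.stalk x) from isReduced_of_isReduced_stalk X
  intro x
  obtain ⟨V, hV, hx, h⟩ := H x
  let := X.presheaf.algebra_section_stalk ⟨x, hx⟩
  have := hV.isLocalization_stalk ⟨x, hx⟩
  exact isReduced_localizationPreserves (hV.primeIdealOf ⟨x, hx⟩).asIdeal.primeCompl _ h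

theorem AlgebraicGeometry.isReduced_of_etale_of_field {K : Type u} [Field K] {X : Scheme.{u}}
    (f : X ⟶ Spec (.of K)) [Etale f] : IsReduced X := by
  refine isReduced_of_forall_exists_isAffineOpen fun x ↦ ?_
  obtain ⟨_, ⟨V, hV, rfl⟩, hx, -⟩ :=
    X.isBasis_affineOpens.exists_subset_of_mem_open (Set.mem_univ x) isOpen_univ
  refine ⟨V, hV, hx, ?_⟩
  have h := RingHom.Etale.stableUnderComposition _ _
    (RingHom.Etale.of_bijective (f := (Scheme.ΓSpecIso (.of K)).inv.hom)
      (ConcreteCategory.bijective_of_isIso (Scheme.ΓSpecIso (.of K)).inv))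
    (f.etale_appLE (isAffineOpen_top _) hV le_top)
  algebraize [(f.appLE ⊤ V le_top).hom.comp (Scheme.ΓSpecIso (.of K)).inv.hom]
  have : Algebra.Etale K Γ(X, V) := RingHom.etale_algebraMap.mp h
  exact Algebra.FormallyUnramified.isReduced_of_field K _

instance AlgebraicGeometry.geometricallyReduced_of_etale {X Y : Scheme.{u}} (f : X ⟶ Y)
    [Etale f] :
    GeometricallyReduced f where
  geometrically_isReduced K _ y T fst snd h := by
    have : Etale snd := MorphismProperty.of_isPullback h ‹_›
    exact isReduced_of_etale_of_field snd

theorem Algebra.Etale.isReduced_of_isNoetherianRing (A B : Type u) 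
    [CommRing A] [CommRing B] [Algebra A B]
    [Algebra.Etale A B] [IsNoetherianRing A] [_root_.IsReduced A] : _root_.IsReduced B := by
  have : AlgebraicGeometry.Etale (Spec.map (CommRingCat.ofHom (algebraMap A B))) := by
    rw [HasRingHomProperty.Spec_iff (P := @AlgebraicGeometry.Etale)]
    exact RingHom.etale_algebraMap.mpr ‹_›
  have := GeometricallyReduced.isReduced_of_flat_of_isLocallyNoetherian
    (Spec.map (CommRingCat.ofHom (algebraMap A B)))
  exact (affine_isReduced_iff (.of B)).mp this

/-- Noetherian reduction: `B` descends to an étale algebra over a finitely generated `ℤ`-subalgebra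
`A₀`, and by flatness reducedness can be tested on base changes to finitely generated
`A₀`-subalgebras of `A`. -/
theorem Algebra.Etale.isReduced (A B : Type u) [CommRing A] [CommRing B] [Algebra A B]
    [Algebra.Etale A B] [_root_.IsReduced A] : _root_.IsReduced B := by
  obtain ⟨A₀, B₀, _, _, hA₀, _, ⟨e⟩⟩ := Algebra.Etale.exists_subalgebra_fg ℤ A B
  have : Algebra.FiniteType ℤ A₀ := A₀.fg_iff_finiteType.mp hA₀
  have : IsNoetherianRing A₀ := Algebra.FiniteType.isNoetherianRing ℤ A₀
  suffices _root_.IsReduced (B₀ ⊗[A₀] A) from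
    isReduced_of_injective (e.toRingEquiv.trans
      (Algebra.TensorProduct.comm A₀ A B₀).toRingEquiv) (RingEquiv.injective _)
  refine IsReduced.tensorProduct_of_flat_of_forall_fg fun C hC ↦ ?_
  have : Algebra.FiniteType A₀ C := C.fg_iff_finiteType.mp hC
  have : IsNoetherianRing C := Algebra.FiniteType.isNoetherianRing A₀ C
  have : _root_.IsReduced C := isReduced_of_injective C.val Subtype.val_injective
  have := Algebra.Etale.isReduced_of_isNoetherianRing C (C ⊗[A₀] B₀)
  exact isReduced_of_injective (Algebra.TensorProduct.comm A₀ B₀ C).toRingEquiv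
    (RingEquiv.injective _)

/-- Locally, a smooth morphism is étale over an affine space. -/
theorem AlgebraicGeometry.isReduced_of_smooth {X Y : Scheme.{u}} (f : X ⟶ Y) [Smooth f]
    [IsReduced Y] : IsReduced X := by
  refine isReduced_of_forall_exists_isAffineOpen fun x ↦ ?_
  obtain ⟨U, hU, V, hV, hx, e, h⟩ := Smooth.exists_isStandardSmooth f x
  refine ⟨V, hV, hx, ?_⟩
  obtain ⟨n, g, -, hg⟩ := h.exists_etale_mvPolynomial
  algebraize [g]
  exact Algebra.Etale.isReduced (MvPolynomial (Fin n) Γ(Y, U)) _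

/-- Over `Z₀` the two maps agree because `g` is mono there; their equalizer is closed as `g` is
separated, and contains a dense open of a reduced scheme. -/
theorem AlgebraicGeometry.hom_ext_of_dense_of_mono_morphismRestrict {X Y Z : Scheme.{u}}
    [IsReduced X] (g : Y ⟶ Z) [IsSeparated g] (Z₀ : Z.Opens) [Mono (g ∣_ Z₀)] {a b : X ⟶ Y}
    (hab : a ≫ g = b ≫ g) (hd : Dense (((a ≫ g) ⁻¹ᵁ Z₀ : X.Opens) : Set X)) : a = b := by
  let W : X.Opens := (a ≫ g) ⁻¹ᵁ Z₀
  have : IsDominant W.ι := ⟨by rwa [DenseRange, Scheme.Opens.range_ι]⟩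
  refine ext_of_isDominant_of_isSeparated g hab W.ι ?_
  have sq := (isPullback_morphismRestrict g Z₀).flip
  have ha : (W.ι ≫ a) ≫ g = ((a ≫ g) ∣_ Z₀) ≫ Z₀.ι := by
    rw [morphismRestrict_ι, Category.assoc]
  have hb : (W.ι ≫ b) ≫ g = ((a ≫ g) ∣_ Z₀) ≫ Z₀.ι := by
    rw [Category.assoc, ← hab, ← Category.assoc, ha]
  have key : sq.lift _ _ ha = sq.lift _ _ hb := by
    rw [← cancel_mono (g ∣_ Z₀), sq.lift_snd, sq.lift_snd]
  rw [← sq.lift_fst _ _ ha, ← sq.lift_fst _ _ hb, key]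

section Shear

variable {C : Type*} [Category* C] [CartesianMonoidalCategory C] (G X : C) [GrpObj G] [ModObj G X]

open CartesianMonoidalCategory

/-- The shear automorphism `(γ, x) ↦ (γ, γ • x)` of `G ⊗ X`, for a group object `G` acting on `X`. -/
@[simps]
def ModObj.shearIso : G ⊗ X ≅ G ⊗ X where
  hom := lift (fst G X) γ[G, X]
  inv := lift (fst G X) ((fst G X)⁻¹ • snd G X)
  hom_inv_id := by
    have h : γ[G, X] = fst G X • snd G X := by simp [Hom.smul_def]
    ext
    · simp
    · simp [ModObj.comp_smul, GrpObj.comp_inv, h]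
  inv_hom_id := by
    have h : γ[G, X] = fst G X • snd G X := by simp [Hom.smul_def]
    ext
    · simp
    · simp [ModObj.comp_smul, h]

theorem ModObj.shearIso_hom_snd : (shearIso G X).hom ≫ snd G X = γ[G, X] := by
  simp

end Shear

section Action

variable {S : Scheme.{u}} (Γ X : Over S) [GrpObj Γ] [ModObj Γ X]

open CartesianMonoidalCategory

theorem smooth_smul_left [Smooth Γ.hom] : Smooth (γ[Γ, X]).left := by
  rw [← ModObj.shearIso_hom_snd, Over.comp_left, Over.snd_left]
  have : Smooth (pullback.snd Γ.hom X.hom) :=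
    inferInstanceAs (Smooth (pullback.snd (Z := S) Γ.hom X.hom))
  have : IsIso (ModObj.shearIso Γ X).hom.left :=
    inferInstanceAs (IsIso ((Over.forget S).map (ModObj.shearIso Γ X).hom))
  infer_instance

theorem smooth_restrictedAction_left [Smooth Γ.hom] (U : X.left.Opens) :
    Smooth (restrictedAction Γ X U).left := by
  have := smooth_smul_left Γ X
  have : Smooth (Γ ◁ openOverι X U).left := by
    rw [Over.whiskerLeft_left]
    have : IsOpenImmersion (openOverι X U).left := inferInstanceAs (IsOpenImmersion U.ι)
    infer_instance
  rw [restrictedAction, Over.comp_left]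
  infer_instance

end Action

theorem AlgebraicGeometry.dense_preimage_of_smooth {X Y : Scheme.{u}} (f : X ⟶ Y) [Smooth f]
    {U : Y.Opens}
    (hU : Dense (U : Set Y)) : Dense ((f ⁻¹ᵁ U : X.Opens) : Set X) :=
  hU.preimage f.isOpenMap

theorem AlgebraicGeometry.exists_lift_of_smooth_of_surjective {V X Y Z : Scheme.{u}} [IsReduced X]
    (π : V ⟶ X) [Smooth π] [Surjective π] (f : X ⟶ Z) (g : Y ⟶ Z) [IsSeparated g]
    (Z₀ : Z.Opens) [Mono (g ∣_ Z₀)] (hd : Dense ((f ⁻¹ᵁ Z₀ : X.Opens) : Set X))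
    (t : V ⟶ Y) (ht : t ≫ g = π ≫ f) : ∃ h : X ⟶ Y, π ≫ h = t ∧ h ≫ g = f := by
  -- The kernel pair is smooth over `X`, so the uniqueness principle applies to it.
  have : IsReduced (pullback π π) := isReduced_of_smooth (pullback.fst π π ≫ π)
  have heq : pullback.fst π π ≫ t = pullback.snd π π ≫ t := by
    refine hom_ext_of_dense_of_mono_morphismRestrict g Z₀ ?_ ?_
    · simp [ht, pullback.condition_assoc]
    · rw [Category.assoc, ht, ← Category.assoc, Scheme.Hom.comp_preimage]
      exact dense_preimage_of_smooth _ hd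
  obtain ⟨h, hh⟩ := IsRegularEpi.exists_of_isKernelPair π (.of_hasPullback π) t heq
  exact ⟨h, hh, by rw [← cancel_epi π, reassoc_of% hh, ht]⟩

section Equivariant

variable {S : Scheme.{u}} (Γ : Over S) [GrpObj Γ] {X Y Z : Over S}
  [ModObj Γ X] [ModObj Γ Y] [ModObj Γ Z] {f : X ⟶ Z} {g : Y ⟶ Z}

theorem whiskerLeft_smul_comp_of_comp_eq [IsModHom Γ f] [IsModHom Γ g] {U : Over S}
    (i : U ⟶ X) (k : U ⟶ Y) (hk : k ≫ g = i ≫ f) :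
    (Γ ◁ k ≫ γ[Γ, Y]) ≫ g = (Γ ◁ i ≫ γ[Γ, X]) ≫ f := by
  have hf : γ[Γ, X] ≫ f = Γ ◁ f ≫ γ[Γ, Z] := IsModHom.smul_hom
  have hg : γ[Γ, Y] ≫ g = Γ ◁ g ≫ γ[Γ, Z] := IsModHom.smul_hom
  rw [Category.assoc, Category.assoc, hf, hg, ← whiskerLeft_comp_assoc,
    ← whiskerLeft_comp_assoc, hk]

theorem isModHom_of_dense [Smooth Γ.hom] [IsReduced X.left] [IsSeparated g.left]
    [IsModHom Γ f] [IsModHom Γ g] (Z₀ : Z.left.Opens) [Mono (g.left ∣_ Z₀)]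
    (hd : Dense ((f.left ⁻¹ᵁ Z₀ : X.left.Opens) : Set X.left))
    (h : X ⟶ Y) (hh : h ≫ g = f) : IsModHom Γ h := by
  have := smooth_smul_left Γ X
  have : IsReduced (Γ ⊗ X).left := isReduced_of_smooth (γ[Γ, X]).left
  have hw := whiskerLeft_smul_comp_of_comp_eq Γ (f := f) (g := g) (𝟙 X) h (by simpa)
  constructor
  ext1
  refine hom_ext_of_dense_of_mono_morphismRestrict g.left Z₀ ?_ ?_
  · rw [← Over.comp_left, ← Over.comp_left]
    congr 1
    simpa [hh] using hw.symm
  · rw [← Over.comp_left, Category.assoc, hh, Over.comp_left, Scheme.Hom.comp_preimage]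
    exact dense_preimage_of_smooth _ hd

end Equivariant

theorem mainTheorem5 (p : ℕ) [Fact p.Prime]
    (Γ : Over (SpecZp.{u} p)) [GrpObj Γ] (hΓ : Smooth Γ.hom)
    (X Y Z : Over (SpecZp.{u} p)) [ModObj Γ X] [ModObj Γ Y] [ModObj Γ Z]
    (f : X ⟶ Z) (g : Y ⟶ Z) (hf : IsModHom Γ f) (hg : IsModHom Γ g)
    (hX : IsReduced X.left) (hgs : IsSeparated g.left)
    (hZ₀ : ∃ Z₀ : Z.left.Opens, Dense (Z₀ : Set Z.left) ∧
      Dense ((f.left ⁻¹ᵁ Z₀ : X.left.Opens) : Set X.left) ∧ IsImmersion (g.left ∣_ Z₀))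
    (U : X.left.Opens) (hU : IsSaturating Γ X U)
    (h_U : (U : Scheme.{u}) ⟶ Y.left) (hh_U : h_U ≫ g.left = U.ι ≫ f.left) :
    (∀ h' : (U : Scheme.{u}) ⟶ Y.left, h' ≫ g.left = U.ι ≫ f.left → h' = h_U) ∧
    ∃ h : X ⟶ Y, h ≫ g = f ∧ U.ι ≫ h.left = h_U ∧
      (∀ h' : X.left ⟶ Y.left, h' ≫ g.left = f.left → h' = h.left) ∧
      IsModHom Γ h ∧ (IsProper f.left → IsProper h.left) := by
  obtain ⟨Z₀, -, hd, _⟩ := hZ₀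
  have uniqU (h' : (U : Scheme.{u}) ⟶ Y.left) (hh' : h' ≫ g.left = U.ι ≫ f.left) :
      h' = h_U := by
    refine hom_ext_of_dense_of_mono_morphismRestrict g.left Z₀ (hh'.trans hh_U.symm) ?_
    rw [hh', Scheme.Hom.comp_preimage]
    exact dense_preimage_of_smooth _ hd
  let k : openOver X U ⟶ Y := Over.homMk h_U (by
    rw [← Over.w g, reassoc_of% hh_U, Over.w f]; rfl)
  have ht := whiskerLeft_smul_comp_of_comp_eq Γ (f := f) (g := g) (openOverι X U) k
    (by ext1; exact hh_U)
  have := smooth_restrictedAction_left Γ X U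
  have : Surjective (restrictedAction Γ X U).left := hU
  obtain ⟨h, -, hhg⟩ := exists_lift_of_smooth_of_surjective (restrictedAction Γ X U).left
    f.left g.left Z₀ hd (Γ ◁ k ≫ γ[Γ, Y]).left congr(($ht).left)
  let H : X ⟶ Y := Over.homMk h (by rw [← Over.w g, reassoc_of% hhg, Over.w f])
  have hH : H ≫ g = f := by ext1; exact hhg
  -- `h|_U = h_U` comes from uniqueness on `U`, with no evaluation at the unit section of `Γ`.
  refine ⟨uniqU, H, hH, uniqU _ ?_, fun h' hh' ↦ ?_, isModHom_of_dense Γ Z₀ hd H hH, fun hp ↦ ?_⟩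
  · exact (Category.assoc _ _ _).trans congr(U.ι ≫ $hhg)
  · refine hom_ext_of_dense_of_mono_morphismRestrict g.left Z₀ (hh'.trans hhg.symm) ?_
    rwa [hh']
  · have : IsProper (H.left ≫ g.left) := by rwa [← Over.comp_left, hH]
    exact IsProper.of_comp H.left g.left
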